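/- \textbf{Corollary (Lie point symmetries of the equivalence class).} Let $n,\delta\in\mathbb{R}$ with $n\neq 0,1$ and $\delta\neq 0$. Let $V\subseteq\mathbb{R}^2$ be a nonempty connected open set of points $(\xi,w)$, and suppose that the Li\'enard equation $$w_{\xi\xi}+f(w)\,w_\xi+g(w)=0 \qquad (f,g:\mathbb{R}\to\mathbb{R})$$ is equivalent on $V$ to the anharmonic oscillator $$y_{xx}+\delta y^{n}=0$$ via a point transformation $y=F(\xi,w)$, $x=G(\xi,w)$. This means that $F,G\in C^\infty(V)$, that $G_\xi F_w-G_wF_\xi\neq0$ on $V$, that the power $y^n$ is defined and smooth at every value $y=F(\xi,w)$, $(\xi,w)\in V$ (that is, $y>0$, or $n\in\mathbb{Z}$ and $y\ne0$ if $n<0$), and that, at every $(\xi,w)\in V$ and for all values of $w_\xi,w_{\xi\xi}$ with $DG\neq0$, the substitution $$y_x=\frac{DF}{DG},\qquad y_{xx}=\frac{D(DF/DG)}{DG},\qquad D=\partial_\xi+w_\xi\partial_w+w_{\xi\xi}\partial_{w_\xi},$$ turns $y_{xx}+\delta y^n=0$ into a condition equivalent to $w_{\xi\xi}+f(w)w_\xi+g(w)=0$.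 Then the smooth vector fields $a(\xi,w)\,\partial_\xi+b(\xi,w)\,\partial_w$ on $V$ that are infinitesimal point symmetries of the Li\'enard equation, i.e. whose second prolongation annihilates $w_{\xi\xi}+f(w)w_\xi+g(w)$ wherever this expression vanishes, form a Lie algebra over $\mathbb{R}$ under the bracket of vector fields. Its dimension is exactly two if $n\neq-3$ and exactly three if $n=-3$. -/

import Mathlib

open scoped ContDiff
open TopologicalSpace (Opens)

/-! ## The Lie algebra of smooth vector fields on an open subset of the plane -/

/-- Smooth vector fields on an open set `U` of the plane.  A field `v` stands for
`v.1 ∂/∂x + v.2 ∂/∂y`; a field on `U` is represented by its extension by zero. -/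
def SmoothVectorFields (U : Opens (ℝ × ℝ)) : Submodule ℝ (ℝ × ℝ → ℝ × ℝ) where
  carrier := {v | ContDiffOn ℝ ∞ v U ∧ ∀ z ∉ U, v z = 0}
  add_mem' := by
    rintro v w ⟨hv, hv0⟩ ⟨hw, hw0⟩
    exact ⟨hv.add hw, fun z hz => by simp [hv0 z hz, hw0 z hz]⟩
  zero_mem' := ⟨contDiffOn_const, fun _ _ => rfl⟩
  smul_mem' := by
    rintro c v ⟨hv, hv0⟩
    exact ⟨contDiffOn_const.smul hv, fun z hz => by simp [hv0 z hz]⟩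

namespace SmoothVectorFields

variable {U : Opens (ℝ × ℝ)}

theorem contDiffAt (v : SmoothVectorFields U) {z : ℝ × ℝ} (hz : z ∈ U) :
    ContDiffAt ℝ ∞ v.1 z :=
  v.2.1.contDiffAt (U.isOpen.mem_nhds hz)

theorem differentiableAt (v : SmoothVectorFields U) {z : ℝ × ℝ} (hz : z ∈ U) :
    DifferentiableAt ℝ v.1 z :=
  (contDiffAt v hz).differentiableAt (by simp)

/-- The Lie bracket of vector fields, `[v, w] = (Dw) v - (Dv) w`. -/
noncomputable instance : Bracket (SmoothVectorFields U) (SmoothVectorFields U) where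
  bracket v w := ⟨VectorField.lieBracket ℝ v.1 w.1, by
    refine ⟨fun z hz => ?_, fun z hz => ?_⟩
    · exact (ContDiffAt.lieBracket_vectorField (n := ∞) (m := ∞) (contDiffAt v hz)
        (contDiffAt w hz) (by simp)).contDiffWithinAt
    · exact VectorField.lieBracket_eq_zero_of_eq_zero (v.2.2 z hz) (w.2.2 z hz)⟩

theorem bracket_apply (v w : SmoothVectorFields U) (z : ℝ × ℝ) :
    (⁅v, w⁆ : SmoothVectorFields U).1 z = VectorField.lieBracket ℝ v.1 w.1 z := rfl

theorem ext_on {v w : SmoothVectorFields U} (h : ∀ z ∈ U, v.1 z = w.1 z) : v = w := by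
  apply Subtype.ext
  funext z
  by_cases hz : z ∈ U
  · exact h z hz
  · rw [v.2.2 z hz, w.2.2 z hz]

noncomputable instance : LieRing (SmoothVectorFields U) where
  add_lie u v w := ext_on fun _ hz =>
    VectorField.lieBracket_add_left (differentiableAt u hz) (differentiableAt v hz)
  lie_add u v w := ext_on fun _ hz =>
    VectorField.lieBracket_add_right (differentiableAt v hz) (differentiableAt w hz)
  lie_self u := ext_on fun z _ => by
    rw [bracket_apply, VectorField.lieBracket_self]; rfl
  leibniz_lie u v w := ext_on fun z hz =>
    VectorField.leibniz_identity_lieBracket (n := ∞)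
      (by simpa using (WithTop.coe_le_coe.2 le_top : ((2 : ℕ∞) : WithTop ℕ∞) ≤ ∞))
      (contDiffAt u hz) (contDiffAt v hz) (contDiffAt w hz)

noncomputable instance : LieAlgebra ℝ (SmoothVectorFields U) where
  lie_smul _ _ w := ext_on fun _ hz =>
    VectorField.lieBracket_const_smul_right (differentiableAt w hz)

end SmoothVectorFields

/-! ## Jets, total derivatives and prolongations

A first-order jet `(x, y, y')` is `((x, y), p) : (ℝ × ℝ) × ℝ`.  A second-order equation
`y'' = Ω (x, y, y')` is given by the function `Ω` of first-order jets. -/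

/-- Total derivative of a function of `(x, y)`: `h_x + p h_y`, a function of first-order jets. -/
noncomputable def totalDeriv (h : ℝ × ℝ → ℝ) (j : (ℝ × ℝ) × ℝ) : ℝ :=
  fderiv ℝ h j.1 (1, j.2)

/-- Total derivative of a function of first-order jets: `h_x + p h_y + q h_p`,
where `q` stands for `y''`. -/
noncomputable def totalDerivJet (h : (ℝ × ℝ) × ℝ → ℝ) (j : (ℝ × ℝ) × ℝ) (q : ℝ) : ℝ :=
  fderiv ℝ h j ((1, j.2), q)

/-- Coefficient of `∂/∂y'` in the prolongation of the vector field `a ∂/∂x + b ∂/∂y`: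
`D b - y' D a`. -/
noncomputable def prolongOne (v : ℝ × ℝ → ℝ × ℝ) (j : (ℝ × ℝ) × ℝ) : ℝ :=
  totalDeriv (fun z => (v z).2) j - j.2 * totalDeriv (fun z => (v z).1) j

/-- Coefficient of `∂/∂y''` in the prolongation of the vector field `a ∂/∂x + b ∂/∂y`:
`D (D b - y' D a) - y'' D a`. -/
noncomputable def prolongTwo (v : ℝ × ℝ → ℝ × ℝ) (j : (ℝ × ℝ) × ℝ) (q : ℝ) : ℝ :=
  totalDerivJet (prolongOne v) j q - q * totalDeriv (fun z => (v z).1) j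

/-- `v` generates Lie point symmetries of `y'' = Ω (x, y, y')` over `U`: the second prolongation
of `v` annihilates `y'' - Ω (x, y, y')` wherever `y'' = Ω (x, y, y')`. -/
def IsPointSymmetry (Ω : (ℝ × ℝ) × ℝ → ℝ) (U : Opens (ℝ × ℝ)) (v : ℝ × ℝ → ℝ × ℝ) : Prop :=
  ∀ z ∈ U, ∀ p : ℝ,
    prolongTwo v (z, p) (Ω (z, p)) = fderiv ℝ Ω (z, p) (v z, prolongOne v (z, p))

/-- The infinitesimal point symmetries of `y'' = Ω (x, y, y')` over `U` form a Lie algebra,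
under the bracket of vector fields, which has finite dimension `d`. -/
def HasPointSymmetryAlgebraOfDim (Ω : (ℝ × ℝ) × ℝ → ℝ) (U : Opens (ℝ × ℝ)) (d : ℕ) : Prop :=
  ∃ L : LieSubalgebra ℝ (SmoothVectorFields U),
    (∀ v : SmoothVectorFields U, v ∈ L ↔ IsPointSymmetry Ω U v.1) ∧
    Module.Finite ℝ L ∧ Module.finrank ℝ L = d

/-! ## Point transformations -/

/-- `y_x` after the substitution `x = G (ξ, w)`, `y = F (ξ, w)`, as a function of
`(ξ, w, w_ξ)`: `D F / D G`. -/
noncomputable def newFirstDeriv (F G : ℝ × ℝ → ℝ) (j : (ℝ × ℝ) × ℝ) : ℝ :=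
  totalDeriv F j / totalDeriv G j

/-- `y_xx` after the substitution `x = G (ξ, w)`, `y = F (ξ, w)`, as a function of
`(ξ, w, w_ξ)` and `q = w_ξξ`: `D (D F / D G) / D G`. -/
noncomputable def newSecondDeriv (F G : ℝ × ℝ → ℝ) (j : (ℝ × ℝ) × ℝ) (q : ℝ) : ℝ :=
  totalDerivJet (newFirstDeriv F G) j q / totalDeriv G j

/-- The smooth nondegenerate substitution `x = G (ξ, w)`, `y = F (ξ, w)` on `V` turns the equation
`y_xx = Ω₂ (x, y, y_x)` into `w_ξξ = Ω₁ (ξ, w, w_ξ)`. The derivatives `y_x` and `y_xx` are defined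
at the jets at which `x` is a local parameter, that is, at which `D G ≠ 0`. -/
structure IsPointEquivalence (Ω₁ Ω₂ : (ℝ × ℝ) × ℝ → ℝ) (V : Opens (ℝ × ℝ))
    (F G : ℝ × ℝ → ℝ) : Prop where
  smooth_F : ContDiffOn ℝ ∞ F V
  smooth_G : ContDiffOn ℝ ∞ G V
  jacobian_ne_zero : ∀ z ∈ V,
    fderiv ℝ G z (1, 0) * fderiv ℝ F z (0, 1) - fderiv ℝ G z (0, 1) * fderiv ℝ F z (1, 0) ≠ 0
  maps_equation : ∀ z ∈ V, ∀ p q : ℝ, totalDeriv G (z, p) ≠ 0 →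
    (newSecondDeriv F G (z, p) q = Ω₂ ((G z, F z), newFirstDeriv F G (z, p)) ↔ q = Ω₁ (z, p))

/-! ## The equations -/

/-- The Liénard equation `w_ξξ + f(w) w_ξ + g(w) = 0`, solved for `w_ξξ`. -/
def lienard (f g : ℝ → ℝ) (j : (ℝ × ℝ) × ℝ) : ℝ := -(f j.1.2 * j.2 + g j.1.2)

/-- The anharmonic oscillator `y_xx + δ y ^ n = 0`, solved for `y_xx`. -/
noncomputable def anharmonic (δ n : ℝ) (j : (ℝ × ℝ) × ℝ) : ℝ := -(δ * j.1.2 ^ n)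

/-- The real power `y ^ n` is defined and smooth at `y`: either `y > 0`, or `n` is an integer and
`y ≠ 0` if that integer is negative.  For integral `n` the power agrees with the usual
integer power, also at negative `y`. -/
def PowerRegularAt (n y : ℝ) : Prop :=
  0 < y ∨ ∃ k : ℤ, n = k ∧ (0 ≤ k ∨ y ≠ 0)

/-!
The symmetry condition is natural under point transformations, so the symmetries of the Liénard
equation on `V` are the pullbacks along `(G, F)` of those of the anharmonic oscillator, whose
determining equations can be solved. Since `(G, F)` need not be injective, nothing is pushed
forward. Instead, all computations take place in the algebra of smooth functions on `V`: with
`x = G` and `y = F`, the nonvanishing of the Jacobian gives commuting derivations `∂_x`, `∂_y` of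
this algebra, and every field on `V` is uniquely `α ∂_x + β ∂_y`.

On first-order jets, let `D` be the total derivative along the Liénard equation and `U` the first
prolongation of a field `a ∂_ξ + b ∂_w`. The field is a symmetry iff the derivation
`[U, D] + (D a) D` kills `w_ξ`; it always kills functions of `(ξ, w)`. Applying `U` to the identity
`Dx D²y - Dy D²x = r (Dx)³`, which says that the equation is `y_xx = r` in the new coordinates,
expresses the defect as a cubic form in `Dx`, `Dy` whose coefficients are the determining equations
of the oscillator (`prolongation_defect_eq`, `isPointSymmetry_iff`). The identity holds at first
only where `DG ≠ 0`; it extends to all jets, and shows that the right-hand side of the Liénard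
equation is smooth on the jets over `V`, by continuity in `w_ξ` (`transformed_equation`).

For `r = -δ yⁿ` the determining equations give `α_y = 0`, `(1 - n) β = 2 y α_x`, `α_xxx = 0` and
`(n + 3) α_xx = 0` (`determining_equations_solution`). On a connected domain this means
`α = c₀ + c₁ x + c₂ x²`, with `c₂ = 0` unless `n = -3` (`determining_iff`). These fields are closed
under the bracket, and depend injectively on the two or three free constants.
-/

/-! ### Prolongation as algebra of derivations -/

/-- Here `A` plays the role of the functions of `(ξ, w)` with the derivations
`d₁ = ∂_ξ`, `d₂ = ∂_w`, and `B` that of the functions of first-order jets, `ι` being the pullback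
and `p` the coordinate `w_ξ`. The derivation `D` is the total derivative along the equation
`w_ξξ = D p`, and `U` is the first prolongation of `a ∂_ξ + b ∂_w`. On functions of `(ξ, w)` the
relation `[U, D] = -(D a) D` holds whether or not `U` is a symmetry. -/
theorem prolonged_total_derivative {A B : Type*} [CommRing A] [Algebra ℝ A] [CommRing B]
    [Algebra ℝ B] (d₁ d₂ : Derivation ℝ A A) (hcomm : ∀ h, d₂ (d₁ h) = d₁ (d₂ h)) (ι : A →ₐ[ℝ] B)
    (D U : Derivation ℝ B B) (p : B) (a b : A)
    (hD : ∀ h, D (ι h) = ι (d₁ h) + p * ι (d₂ h))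
    (hU : ∀ h, U (ι h) = ι (a * d₁ h + b * d₂ h))
    (hUp : U p = D (ι b) - p * D (ι a)) (h : A) :
    U (D (ι h)) = D (U (ι h)) - D (ι a) * D (ι h) := by
  simp only [hD, hU, map_add, map_mul, hUp, Derivation.leibniz, smul_eq_mul, hcomm]
  ring

/-- In the setting of `prolonged_total_derivative`, the derivation `[U, D] + (D a) D` kills `ι A`
and maps `p` to the defect `U (D p) - D (U p) + (D a) (D p)` of the symmetry condition, so it maps
`D (ι h) = h_ξ + p h_w` to `h_w` times the defect. -/
theorem prolonged_second_derivative {A B : Type*} [CommRing A] [Algebra ℝ A] [CommRing B]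
    [Algebra ℝ B] (d₁ d₂ : Derivation ℝ A A) (hcomm : ∀ h, d₂ (d₁ h) = d₁ (d₂ h)) (ι : A →ₐ[ℝ] B)
    (D U : Derivation ℝ B B) (p : B) (a b : A)
    (hD : ∀ h, D (ι h) = ι (d₁ h) + p * ι (d₂ h))
    (hU : ∀ h, U (ι h) = ι (a * d₁ h + b * d₂ h))
    (hUp : U p = D (ι b) - p * D (ι a)) (h : A) :
    U (D (D (ι h))) = D (U (D (ι h))) - D (ι a) * D (D (ι h)) +
      ι (d₂ h) * (U (D p) - D (U p) + D (ι a) * D p) := by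
  simp only [hD, hU, map_add, map_mul, hUp, Derivation.leibniz, smul_eq_mul, hcomm, map_sub]
  ring

/-- Naturality of the symmetry condition. Let `x`, `y` be new coordinates with dual derivations
`X`, `Y`, and let `hr` say that the equation reads `y_xx = r` in them. Up to the Jacobian, the
defect of `U = a ∂_ξ + b ∂_w = α ∂_x + β ∂_y` is a homogeneous cubic form in `D x` and `D y`, whose
coefficients are the determining equations of `y_xx = r` for the field `α ∂_x + β ∂_y`. -/
theorem prolongation_defect_eq {A B : Type*} [CommRing A] [Algebra ℝ A] [CommRing B]
    [Algebra ℝ B] (d₁ d₂ : Derivation ℝ A A) (hcomm : ∀ h, d₂ (d₁ h) = d₁ (d₂ h)) (ι : A →ₐ[ℝ] B)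
    (D U : Derivation ℝ B B) (p : B) (a b : A)
    (hD : ∀ h, D (ι h) = ι (d₁ h) + p * ι (d₂ h))
    (hU : ∀ h, U (ι h) = ι (a * d₁ h + b * d₂ h))
    (hUp : U p = D (ι b) - p * D (ι a))
    (X Y : Derivation ℝ A A) (hXY : ∀ h, Y (X h) = X (Y h)) (x y r α β : A)
    (h₁ : ∀ h, d₁ h = d₁ x * X h + d₁ y * Y h) (h₂ : ∀ h, d₂ h = d₂ x * X h + d₂ y * Y h)
    (hα : α = a * d₁ x + b * d₂ x) (hβ : β = a * d₁ y + b * d₂ y)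
    (hr : D (ι x) * D (D (ι y)) - D (ι y) * D (D (ι x)) = ι r * D (ι x) ^ 3) :
    ι (d₁ x * d₂ y - d₂ x * d₁ y) * (U (D p) - D (U p) + D (ι a) * D p) =
      ι (α * X r + β * Y r + 2 * r * X α - r * Y β - X (X β)) * D (ι x) ^ 3 +
      ι (3 * r * Y α - 2 * X (Y β) + X (X α)) * (D (ι x) ^ 2 * D (ι y)) +
      ι (2 * X (Y α) - Y (Y β)) * (D (ι x) * D (ι y) ^ 2) +
      ι (Y (Y α)) * D (ι y) ^ 3 := by
  have hDXY : ∀ h, D (ι h) = D (ι x) * ι (X h) + D (ι y) * ι (Y h) := fun h => by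
    rw [hD, hD x, hD y, h₁ h, h₂ h]; simp only [map_add, map_mul]; ring
  have hUXY : ∀ h, U (ι h) = ι α * ι (X h) + ι β * ι (Y h) := fun h => by
    rw [hU, h₁ h, h₂ h, hα, hβ]; simp only [map_add, map_mul]; ring
  have e1 := prolonged_total_derivative d₁ d₂ hcomm ι D U p a b hD hU hUp
  have e2 := prolonged_second_derivative d₁ d₂ hcomm ι D U p a b hD hU hUp
  have hUx : U (ι x) = ι α := by rw [hU, hα]
  have hUy : U (ι y) = ι β := by rw [hU, hβ]
  -- the defect enters through `U (D (D x))` and `U (D (D y))` when `U` is applied to `hr`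
  have key := congrArg U hr
  have hJ : ι (d₁ x * d₂ y - d₂ x * d₁ y) = D (ι x) * ι (d₂ y) - D (ι y) * ι (d₂ x) := by
    rw [hD, hD]; simp only [map_sub, map_mul]; ring
  rw [hJ]
  simp only [map_sub, Derivation.leibniz, Derivation.leibniz_pow, smul_eq_mul, e2, e1 x, e1 y, hUx,
    hUy, nsmul_eq_mul]
    at key
  have second : ∀ h, D (D (ι h)) = D (D (ι x)) * ι (X h) + D (D (ι y)) * ι (Y h) +
      D (ι x) ^ 2 * ι (X (X h)) + 2 * D (ι x) * D (ι y) * ι (X (Y h)) + D (ι y) ^ 2 * ι (Y (Y h)) :=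
      fun h => by
    rw [hDXY h]; simp only [map_add, Derivation.leibniz, smul_eq_mul]
    rw [hDXY (X h), hDXY (Y h), hXY]; ring
  rw [second α, second β, hUXY r, hDXY α, hDXY β] at key
  simp only [map_add, map_sub, map_mul, map_ofNat]
  generalize U (D p) - D (U p) + D (ι a) * D p = σ at *
  push_cast at key
  linear_combination key + (3 * D (ι a) - ι (X α) - ι (Y β)) * hr

/-- The derivations `∂_x`, `∂_y` with respect to new coordinates, by Cramer's rule. -/
theorem exists_dual_derivations {A : Type*} [CommRing A] [Algebra ℝ A]
    (d₁ d₂ : Derivation ℝ A A) (x y : A) (hJ : IsUnit (d₁ x * d₂ y - d₂ x * d₁ y)) :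
    ∃ X Y : Derivation ℝ A A,
      (∀ h, d₁ h = d₁ x * X h + d₁ y * Y h) ∧ (∀ h, d₂ h = d₂ x * X h + d₂ y * Y h) ∧
      X x = 1 ∧ X y = 0 ∧ Y x = 0 ∧ Y y = 1 := by
  obtain ⟨i, hi⟩ := hJ.exists_left_inv
  refine ⟨i • (d₂ y • d₁ - d₁ y • d₂), i • (d₁ x • d₂ - d₂ x • d₁), fun h => ?_, fun h => ?_,
    ?_, ?_, ?_, ?_⟩ <;>
  simp only [Derivation.smul_apply, Derivation.sub_apply, smul_eq_mul]
  · linear_combination (-d₁ h) * hi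
  · linear_combination (-d₂ h) * hi
  · linear_combination hi
  · ring
  · ring
  · linear_combination hi

/-- By the chain rule, `d₂ d₁ - d₁ d₂` is the Jacobian times `Y X - X Y`. -/
theorem dual_derivations_commute {A : Type*} [CommRing A] [Algebra ℝ A]
    (d₁ d₂ X Y : Derivation ℝ A A) (hcomm : ∀ h, d₂ (d₁ h) = d₁ (d₂ h)) (x y : A)
    (hJ : IsUnit (d₁ x * d₂ y - d₂ x * d₁ y))
    (h₁ : ∀ h, d₁ h = d₁ x * X h + d₁ y * Y h) (h₂ : ∀ h, d₂ h = d₂ x * X h + d₂ y * Y h) (h : A) :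
    Y (X h) = X (Y h) := by
  have e := hcomm h
  rw [h₁ h, h₂ h] at e
  simp only [map_add, Derivation.leibniz, smul_eq_mul, hcomm] at e
  refine hJ.mul_left_cancel ?_
  linear_combination e - d₁ x * h₂ (X h) - d₁ y * h₂ (Y h) + d₂ x * h₁ (X h) + d₂ y * h₁ (Y h)

/-- A binary cubic form vanishes if it vanishes on an affine line that avoids the origin:
by homogeneity it vanishes on every line through the origin that meets the affine line, hence
everywhere. -/
theorem cubic_form_eq_zero {t₀ t₁ s₀ s₁ e₀ e₁ e₂ e₃ : ℝ} (hJ : t₀ * s₁ - t₁ * s₀ ≠ 0)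
    (h : ∀ p : ℝ, e₀ * (t₀ + p * t₁) ^ 3 + e₁ * ((t₀ + p * t₁) ^ 2 * (s₀ + p * s₁)) +
      e₂ * ((t₀ + p * t₁) * (s₀ + p * s₁) ^ 2) + e₃ * (s₀ + p * s₁) ^ 3 = 0) :
    e₀ = 0 ∧ e₁ = 0 ∧ e₂ = 0 ∧ e₃ = 0 := by
  have key : ∀ m k : ℝ, e₀ * m ^ 3 + e₁ * (m ^ 2 * k) + e₂ * (m * k ^ 2) + e₃ * k ^ 3 = 0 := by
    intro m k
    refine (mul_eq_zero.1 ?_).resolve_left (pow_ne_zero 3 hJ)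
    set s := m * s₁ - k * t₁
    set t := k * t₀ - m * s₀
    have hm : (t₀ * s₁ - t₁ * s₀) * m = t₀ * s + t₁ * t := by simp only [s, t]; ring
    have hk : (t₀ * s₁ - t₁ * s₀) * k = s₀ * s + s₁ * t := by simp only [s, t]; ring
    have : e₀ * (t₀ * s + t₁ * t) ^ 3 + e₁ * ((t₀ * s + t₁ * t) ^ 2 * (s₀ * s + s₁ * t)) +
      e₂ * ((t₀ * s + t₁ * t) * (s₀ * s + s₁ * t) ^ 2) + e₃ * (s₀ * s + s₁ * t) ^ 3 = 0 := by
      clear_value s t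
      -- a cubic in `t` is recovered from its values at `0`, `1`, `-1`, `2`
      linear_combination (s ^ 3 - s ^ 2 * t / 2 - s * t ^ 2 + t ^ 3 / 2) * h 0 +
        (s ^ 2 * t + s * t ^ 2 / 2 - t ^ 3 / 2) * h 1 +
        (-s ^ 2 * t / 3 + s * t ^ 2 / 2 - t ^ 3 / 6) * h (-1) +
        (-s ^ 2 * t / 6 + t ^ 3 / 6) * h 2
    rw [← hm, ← hk] at this
    linear_combination this
  have h₁ := key 1 0
  have h₂ := key 0 1
  have h₃ := key 1 1
  have h₄ := key 1 (-1)
  refine ⟨?_, ?_, ?_, ?_⟩ <;> linarith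

/-! ### The determining equations of the anharmonic oscillator -/

/-- The solutions of the determining equations of `y_xx + δ yⁿ = 0` satisfy `α_y = 0`,
`(1 - n) β = 2 y α_x`, `α_xxx = 0` and `(n + 3) α_xx = 0`. The elements `u`, `u'` stand for `yⁿ` and
`yⁿ⁻¹`. Since `y` may vanish at some points when `n` is a positive integer, it is not assumed to be
invertible, only that `y` and `u` are not zero divisors. -/
theorem determining_equations_solution {A : Type*} [CommRing A] [Algebra ℝ A]
    (X Y : Derivation ℝ A A) (hXY : ∀ h, Y (X h) = X (Y h)) (n δ : ℝ)
    (hn0 : n ≠ 0) (hn1 : n ≠ 1) (hδ : δ ≠ 0) (y u u' α β : A)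
    (hXy : X y = 0) (hYy : Y y = 1) (hYu : Y u = algebraMap ℝ A n * u')
    (huy : u = y * u')
    (hu : ∀ h, u * h = 0 → h = 0) (hy : ∀ h, y * h = 0 → h = 0)
    (E3 : Y (Y α) = 0) (E2 : Y (Y β) = 2 * X (Y α))
    (E1 : X (X α) - 2 * X (Y β) = algebraMap ℝ A δ * u * (3 * Y α))
    (E0 : X (X β) = algebraMap ℝ A δ * u * Y β - algebraMap ℝ A δ * u * (2 * X α)
      - algebraMap ℝ A δ * algebraMap ℝ A n * u' * β) :
    Y α = 0 ∧ (1 - algebraMap ℝ A n) * β = 2 * (y * X α) ∧ X (X (X α)) = 0 ∧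
      (algebraMap ℝ A n + 3) * X (X α) = 0 := by
  have cancel : ∀ (c : ℝ) (h : A), c ≠ 0 → algebraMap ℝ A c * h = 0 → h = 0 := fun c h hc e => by
    have := congrArg (algebraMap ℝ A c⁻¹ * ·) e
    simpa [← mul_assoc, ← map_mul, hc] using this
  have two : ∀ h : A, 2 * h = 0 → h = 0 := fun h e =>
    cancel 2 h two_ne_zero (by rwa [map_ofNat (algebraMap ℝ A) 2])
  set N := algebraMap ℝ A n
  set d := algebraMap ℝ A δ
  have dN : ∀ Z : Derivation ℝ A A, Z N = 0 := fun Z => Z.map_algebraMap n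
  have dd : ∀ Z : Derivation ℝ A A, Z d = 0 := fun Z => Z.map_algebraMap δ
  have dtwo : ∀ Z : Derivation ℝ A A, Z 2 = 0 := fun Z => by simpa using Z.map_natCast 2
  have dthree : ∀ Z : Derivation ℝ A A, Z 3 = 0 := fun Z => by simpa using Z.map_natCast 3
  have cN : ∀ h, d * (N * (N - 1)) * h = 0 → h = 0 := fun h e => by
    refine cancel (δ * (n * (n - 1))) h (mul_ne_zero hδ (mul_ne_zero hn0 (sub_ne_zero.2 hn1))) ?_
    simpa [N, d] using e
  have y1 : y * Y u' = (N - 1) * u' := by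
    have := congrArg Y huy
    simp only [Derivation.leibniz, smul_eq_mul, hYu, hYy] at this
    linear_combination -this
  have y2 : y * Y (Y u') = (N - 2) * Y u' := by
    have := congrArg Y y1
    simp only [Derivation.leibniz, smul_eq_mul, hYy, map_sub, dN,
      Derivation.map_one_eq_zero] at this
    linear_combination this
  -- `∂_y²` removes from the equation everything but the multiple of `(yⁿ)_yy α_y`
  have A1 : Y α = 0 := by
    have e := congrArg (fun t => Y (Y t)) E1
    simp only [map_sub, map_add, map_zero, Derivation.leibniz, smul_eq_mul, hXY, E3, E2,
      hYu, dN, dd, dtwo, dthree, mul_zero, add_zero] at e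
    have : d * (N * (N - 1)) * (u * (3 * Y α)) = 0 := by
      rw [huy]; linear_combination (-y ^ 2) * e - 3 * N * d * Y α * y * y1
    exact cancel 3 _ three_ne_zero (by rw [map_ofNat (algebraMap ℝ A) 3]; exact hu _ (cN _ this))
  have B2 : Y (Y β) = 0 := by rw [E2, A1]; simp
  have B1 : X (X α) = 2 * X (Y β) := by
    rw [A1] at E1; linear_combination E1
  -- `∂_y²` of the remaining equation, multiplied by a power of `y`, is a multiple of `yⁿ`
  have F1 : y * (Y β + 2 * X α) + (N - 2) * β = 0 := by
    have e := congrArg (fun t => Y (Y t)) E0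
    simp only [map_sub, map_add, map_zero, Derivation.leibniz, smul_eq_mul, hXY, A1, B2,
      hYu, dN, dd, dtwo, mul_zero, add_zero, zero_add] at e
    have : d * (N * (N - 1)) * (u * (y * (Y β + 2 * X α) + (N - 2) * β)) = 0 := by
      rw [huy]
      linear_combination y ^ 3 * e + d * N * y ^ 2 * (-Y β - 2 * X α) * y1 -
        d * N * β * y * (y * y2 + (N - 2) * y1)
    exact hu _ (cN _ this)
  have F2 : (N - 1) * Y β + 2 * X α = 0 := by
    have e := congrArg Y F1
    simp only [map_sub, map_add, map_zero, Derivation.leibniz, smul_eq_mul, hXY, A1, B2,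
      hYy, dN, dtwo, mul_zero, add_zero, zero_add] at e
    linear_combination e
  have F3 : (N + 3) * X (X α) = 0 := by
    have e := congrArg X F2
    simp only [map_sub, map_add, map_zero, Derivation.leibniz, smul_eq_mul, dN, dtwo,
      Derivation.map_one_eq_zero, mul_zero, add_zero] at e
    linear_combination 2 * e + (N - 1) * B1
  have F4 : β = y * Y β := by
    -- for `n = 2` the factor `n - 2` of `β` in `F1` is lost, and the undifferentiated equation
    -- `E0` supplies the missing relation
    by_cases hn2 : n = 2
    · have hN : N = 2 := by simp only [N, hn2]; exact map_ofNat (algebraMap ℝ A) 2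
      rw [hN] at F2 F3 E0 y1 hYu
      have hA : X (X α) = 0 := cancel 5 _ (by norm_num) (by
        rw [map_ofNat]; linear_combination F3)
      have hB : X (Y β) = 0 := two _ (by rw [← B1, hA])
      have e := congrArg Y E0
      simp only [map_sub, map_zero, Derivation.leibniz, smul_eq_mul, hXY, A1, B2, hB,
        hYu, dd, dtwo, mul_zero, add_zero, zero_add] at e
      have : u * (β - y * Y β) = 0 := cancel (2 * δ) _ (mul_ne_zero two_ne_zero hδ) (by
        rw [map_mul, map_ofNat, huy]
        linear_combination y ^ 2 * e - 2 * d * y ^ 2 * u' * F2 - 2 * d * β * y * y1)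
      exact sub_eq_zero.1 (hu _ this)
    · refine sub_eq_zero.1 (cancel (n - 2) _ (sub_ne_zero.2 hn2) ?_)
      rw [map_sub, map_ofNat]
      linear_combination F1 - y * F2
  refine ⟨A1, by linear_combination (1 - N) * F4 - y * F2, ?_, F3⟩
  have hB : X (X β) = 0 := by
    rw [E0]; nth_rw 2 [F4]; rw [huy]; linear_combination (-d * y * u') * F2
  have : y * X (X (X α)) = 0 := by
    have e := hB
    rw [F4] at e
    simp only [Derivation.leibniz, smul_eq_mul, hXy, mul_zero, add_zero] at e
    rw [B1]
    simp only [Derivation.leibniz, smul_eq_mul, dtwo, mul_zero, add_zero]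
    linear_combination 2 * e
  exact hy _ this

/-! ### Real powers -/

theorem PowerRegularAt.sub_one {n y : ℝ} (hn : n ≠ 0) (h : PowerRegularAt n y) :
    PowerRegularAt (n - 1) y := by
  obtain h | ⟨k, rfl, h⟩ := h
  · exact Or.inl h
  · refine Or.inr ⟨k - 1, by push_cast; ring, ?_⟩
    have : k ≠ 0 := by exact_mod_cast hn
    exact h.imp_left fun _ => by omega

/-- At `y = 0` the exponent is a natural number, and the real power is a monomial. -/
theorem PowerRegularAt.contDiffAt {n y : ℝ} (h : PowerRegularAt n y) :
    ContDiffAt ℝ ∞ (fun t : ℝ => t ^ n) y := by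
  by_cases hy : y = 0
  · obtain h | ⟨k, rfl, h⟩ := h
    · exact absurd hy h.ne'
    · obtain ⟨m, rfl⟩ := Int.eq_ofNat_of_zero_le (h.resolve_right (not_not.2 hy))
      simp only [Int.cast_natCast, Real.rpow_natCast]
      exact contDiffAt_id.pow m
  · exact Real.contDiffAt_rpow_const_of_ne hy

theorem rpow_eq_mul_rpow_sub_one {n : ℝ} (hn : n ≠ 0) (y : ℝ) :
    y ^ n = y * y ^ (n - 1) := by
  by_cases hy : y = 0
  · rw [hy, Real.zero_rpow hn, zero_mul]
  · rw [Real.rpow_sub_one hy, mul_div_cancel₀ _ hy]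

theorem PowerRegularAt.rpow_ne_zero {n y : ℝ} (h : PowerRegularAt n y) (hy : y ≠ 0) :
    y ^ n ≠ 0 := by
  obtain h | ⟨k, rfl, -⟩ := h
  · exact (Real.rpow_pos_of_pos h n).ne'
  · rw [Real.rpow_intCast]
    exact zpow_ne_zero k hy

/-- The pair `(a(x), k y a'(x))`, where `a` is the polynomial of degree at most two with the given
coefficients; it encodes the field `a(x) ∂_x + k y a'(x) ∂_y`. -/
noncomputable def quadraticPair {A : Type*} [CommRing A] [Algebra ℝ A] (k : ℝ) (x y : A) :
    ℝ × ℝ × ℝ →ₗ[ℝ] A × A where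
  toFun c := (algebraMap ℝ A c.1 + algebraMap ℝ A c.2.1 * x + algebraMap ℝ A c.2.2 * x ^ 2,
    algebraMap ℝ A k * y * (algebraMap ℝ A c.2.1 + 2 * algebraMap ℝ A c.2.2 * x))
  map_add' c c' := by
    ext <;> simp <;> ring
  map_smul' t c := by
    ext <;> simp [Algebra.smul_def] <;> ring

section Solutions

variable {A : Type*} [CommRing A] [Algebra ℝ A] (X Y : Derivation ℝ A A) {x y : A}

theorem fst_derivs_quadraticPair (k : ℝ) (hXx : X x = 1) (hYx : Y x = 0) (c : ℝ × ℝ × ℝ) :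
    X (quadraticPair k x y c).1 = algebraMap ℝ A c.2.1 + 2 * algebraMap ℝ A c.2.2 * x ∧
      Y (quadraticPair k x y c).1 = 0 := by
  constructor <;>
  simp only [quadraticPair, LinearMap.coe_mk, AddHom.coe_mk, map_add, Derivation.leibniz,
    Derivation.leibniz_pow, Derivation.map_algebraMap, smul_eq_mul, hXx, hYx, nsmul_eq_mul]
  · push_cast; ring
  · ring

theorem snd_derivs_quadraticPair (k : ℝ) (hXx : X x = 1) (hYx : Y x = 0) (hXy : X y = 0)
    (hYy : Y y = 1) (c : ℝ × ℝ × ℝ) :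
    X (quadraticPair k x y c).2 = 2 * algebraMap ℝ A k * algebraMap ℝ A c.2.2 * y ∧
      Y (quadraticPair k x y c).2 =
        algebraMap ℝ A k * (algebraMap ℝ A c.2.1 + 2 * algebraMap ℝ A c.2.2 * x) := by
  have two : ∀ Z : Derivation ℝ A A, Z 2 = 0 := fun Z => by simpa using Z.map_natCast 2
  constructor <;>
  simp only [quadraticPair, LinearMap.coe_mk, AddHom.coe_mk, map_add, Derivation.leibniz,
    Derivation.map_algebraMap, smul_eq_mul, hXx, hYx, hXy, hYy, two] <;> ring

theorem quadraticPair_injective [Nontrivial A] (k : ℝ) (hXx : X x = 1) (hYx : Y x = 0) :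
    Function.Injective (quadraticPair k x y) := by
  rw [injective_iff_map_eq_zero]
  intro c hc
  have two : ∀ Z : Derivation ℝ A A, Z 2 = 0 := fun Z => by simpa using Z.map_natCast 2
  have inj := FaithfulSMul.algebraMap_injective ℝ A
  have e₁ := (fst_derivs_quadraticPair X Y (y := y) k hXx hYx c).1
  have e₀ : algebraMap ℝ A c.1 + algebraMap ℝ A c.2.1 * x + algebraMap ℝ A c.2.2 * x ^ 2 = 0 :=
    congrArg Prod.fst hc
  rw [hc, Prod.fst_zero, map_zero] at e₁
  have e₂ := congrArg X e₁
  simp only [map_zero, map_add, Derivation.leibniz, Derivation.map_algebraMap, smul_eq_mul, hXx,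
    two] at e₂
  have h₂ : c.2.2 = 0 := by
    have : algebraMap ℝ A (2 * c.2.2) = algebraMap ℝ A 0 := by
      rw [map_mul, map_ofNat, map_zero]; linear_combination -e₂
    linarith [inj this]
  have h₁ : c.2.1 = 0 := inj (by rw [h₂, map_zero] at e₁; rw [map_zero]; linear_combination -e₁)
  have h₀ : c.1 = 0 := inj (by
    rw [h₂, h₁, map_zero] at e₀; rw [map_zero]; linear_combination e₀)
  ext <;> assumption

/-- The fields `a(x) ∂_x + k y a'(x) ∂_y` with `a` quadratic are closed under the bracket, for every
`k`; the structure constants are those of `sl₂`. -/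
theorem quadraticPair_bracket (k : ℝ) (hXx : X x = 1) (hYx : Y x = 0) (hXy : X y = 0)
    (hYy : Y y = 1) (c c' : ℝ × ℝ × ℝ) :
    quadraticPair k x y (c.1 * c'.2.1 - c.2.1 * c'.1, 2 * (c.1 * c'.2.2 - c.2.2 * c'.1),
        c.2.1 * c'.2.2 - c.2.2 * c'.2.1) =
      ((quadraticPair k x y c).1 * X (quadraticPair k x y c').1 +
          (quadraticPair k x y c).2 * Y (quadraticPair k x y c').1 -
        ((quadraticPair k x y c').1 * X (quadraticPair k x y c).1 +
          (quadraticPair k x y c').2 * Y (quadraticPair k x y c).1),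
       (quadraticPair k x y c).1 * X (quadraticPair k x y c').2 +
          (quadraticPair k x y c).2 * Y (quadraticPair k x y c').2 -
        ((quadraticPair k x y c').1 * X (quadraticPair k x y c).2 +
          (quadraticPair k x y c').2 * Y (quadraticPair k x y c).2)) := by
  obtain ⟨p₁, p₂⟩ := fst_derivs_quadraticPair X Y (y := y) k hXx hYx c
  obtain ⟨q₁, q₂⟩ := snd_derivs_quadraticPair X Y k hXx hYx hXy hYy c
  obtain ⟨p₁', p₂'⟩ := fst_derivs_quadraticPair X Y (y := y) k hXx hYx c'
  obtain ⟨q₁', q₂'⟩ := snd_derivs_quadraticPair X Y k hXx hYx hXy hYy c'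
  rw [p₁, p₂, q₁, q₂, p₁', p₂', q₁', q₂']
  ext1 <;>
  simp only [quadraticPair, LinearMap.coe_mk, AddHom.coe_mk, map_sub, map_mul, map_ofNat] <;> ring

/-- Integration of the determining equations, `hconst` being the connectedness of the domain. -/
theorem determining_iff [Nontrivial A] (hXY : ∀ h, Y (X h) = X (Y h)) {n δ : ℝ}
    (hn0 : n ≠ 0) (hn1 : n ≠ 1) (hδ : δ ≠ 0) {u u' : A}
    (hXx : X x = 1) (hYx : Y x = 0)
    (hXy : X y = 0) (hYy : Y y = 1) (hXu : X u = 0) (hYu : Y u = algebraMap ℝ A n * u')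
    (huy : u = y * u')
    (hu : ∀ h, u * h = 0 → h = 0) (hy : ∀ h, y * h = 0 → h = 0)
    (hconst : ∀ h, X h = 0 → Y h = 0 → ∃ c : ℝ, h = algebraMap ℝ A c)
    {r : A} (hr : r = -(algebraMap ℝ A δ * u)) (s : A × A) :
    (s.1 * X r + s.2 * Y r + 2 * r * X s.1 - r * Y s.2 - X (X s.2) = 0 ∧
      3 * r * Y s.1 - 2 * X (Y s.2) + X (X s.1) = 0 ∧
      2 * X (Y s.1) - Y (Y s.2) = 0 ∧ Y (Y s.1) = 0) ↔
    ∃ c : ℝ × ℝ × ℝ, (n ≠ -3 → c.2.2 = 0) ∧ quadraticPair (2 / (1 - n)) x y c = s := by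
  have hk : (1 - algebraMap ℝ A n) * algebraMap ℝ A (2 / (1 - n)) = 2 := by
    rw [← map_one (algebraMap ℝ A), ← map_sub, ← map_mul,
      mul_div_cancel₀ _ (sub_ne_zero.2 hn1.symm), map_ofNat]
  have two : ∀ Z : Derivation ℝ A A, Z 2 = 0 := fun Z => by simpa using Z.map_natCast 2
  have hXr : X r = 0 := by rw [hr]; simp [hXu]
  have hYr : Y r = -(algebraMap ℝ A δ * (algebraMap ℝ A n * u')) := by rw [hr]; simp [hYu]
  constructor
  · rintro ⟨E0, E1, E2, E3⟩
    rw [hXr, hYr] at E0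
    obtain ⟨hα, hβ, h3, h2⟩ := determining_equations_solution X Y hXY n δ hn0 hn1 hδ y u u'
      s.1 s.2 hXy hYy hYu huy hu hy E3 (by linear_combination -E2)
      (by rw [hr] at E1; linear_combination E1)
      (by rw [hr] at E0; linear_combination -E0)
    obtain ⟨a, ha⟩ := hconst (X (X s.1)) h3 (by rw [hXY, hXY, hα, map_zero, map_zero])
    obtain ⟨b, hb⟩ := hconst (X s.1 - algebraMap ℝ A a * x)
      (by simp [ha, hXx]) (by simp [hXY, hα, hYx])
    have half : algebraMap ℝ A a = 2 * algebraMap ℝ A (a / 2) := by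
      rw [← map_ofNat (algebraMap ℝ A) 2, ← map_mul, mul_div_cancel₀ _ two_ne_zero]
    obtain ⟨d, hd⟩ := hconst (s.1 - algebraMap ℝ A b * x - algebraMap ℝ A (a / 2) * x ^ 2)
      (by
        simp only [map_sub, Derivation.leibniz, Derivation.leibniz_pow, Derivation.map_algebraMap,
          smul_eq_mul, nsmul_eq_mul, hXx]
        push_cast
        linear_combination hb + x * half)
      (by simp [hα, hYx])
    refine ⟨(d, b, a / 2), fun hn => ?_, ?_⟩
    · have e : algebraMap ℝ A ((n + 3) * a) = algebraMap ℝ A 0 := by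
        rw [map_mul, map_add, map_ofNat, map_zero, ← ha, h2]
      have e' := FaithfulSMul.algebraMap_injective ℝ A e
      have : n + 3 ≠ 0 := fun h => hn (by linarith)
      simp [(mul_eq_zero.1 e').resolve_left this]
    · refine Prod.ext ?_ ?_
      · change algebraMap ℝ A d + algebraMap ℝ A b * x + algebraMap ℝ A (a / 2) * x ^ 2 = s.1
        rw [← hd]; ring
      · change algebraMap ℝ A (2 / (1 - n)) * y *
          (algebraMap ℝ A b + 2 * algebraMap ℝ A (a / 2) * x) = s.2
        rw [← hb, ← half]
        have hH : algebraMap ℝ A (1 / 2) * 2 = 1 := by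
          rw [← map_ofNat (algebraMap ℝ A) 2, ← map_mul, div_mul_cancel₀ _ two_ne_zero, map_one]
        set H := algebraMap ℝ A (1 / 2)
        set K := algebraMap ℝ A (2 / (1 - n))
        linear_combination (-H * K) * hβ + (H * s.2) * hk - (K * y * X s.1 - s.2) * hH
  · rintro ⟨c, hc, rfl⟩
    obtain ⟨p₁, p₂⟩ := fst_derivs_quadraticPair X Y (y := y) (2 / (1 - n)) hXx hYx c
    obtain ⟨q₁, q₂⟩ := snd_derivs_quadraticPair X Y (2 / (1 - n)) hXx hYx hXy hYy c
    have hs : (quadraticPair (2 / (1 - n)) x y c).2 = algebraMap ℝ A (2 / (1 - n)) * y *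
      (algebraMap ℝ A c.2.1 + 2 * algebraMap ℝ A c.2.2 * x) := rfl
    have hc' : (1 - 2 * algebraMap ℝ A (2 / (1 - n))) * algebraMap ℝ A c.2.2 = 0 := by
      by_cases hn : n = -3
      · have : (2 : ℝ) * (2 / (1 - n)) = 1 := by rw [hn]; norm_num
        rw [← map_ofNat (algebraMap ℝ A) 2, ← map_mul, this, map_one, sub_self, zero_mul]
      · rw [hc hn, map_zero, mul_zero]
    rw [p₁, p₂, q₁, q₂, hXr, hYr, hs]
    simp only [map_add, Derivation.leibniz, Derivation.map_algebraMap, smul_eq_mul, two, hXx, hYx,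
      hXy, map_zero]
    refine ⟨?_, ?_, ?_, trivial⟩
    · rw [hr, huy]
      linear_combination (algebraMap ℝ A δ * y * u' *
        (algebraMap ℝ A c.2.1 + 2 * algebraMap ℝ A c.2.2 * x)) * hk
    · linear_combination 2 * hc'
    · ring

end Solutions

/-! ### Smooth functions on an open set and their derivations -/

/-- The algebra of smooth real functions on an open subset of a normed space. -/
def smoothFunctions {E : Type*} [NormedAddCommGroup E] [NormedSpace ℝ E] (U : Opens E) :
    Subalgebra ℝ (U → ℝ) where
  carrier := {h | ∃ H : E → ℝ, ContDiffOn ℝ ∞ H U ∧ ∀ z : U, h z = H z}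
  add_mem' := by
    rintro h k ⟨H, hH, eH⟩ ⟨K, hK, eK⟩
    exact ⟨fun z => H z + K z, hH.add hK, fun z => by simp [eH, eK]⟩
  mul_mem' := by
    rintro h k ⟨H, hH, eH⟩ ⟨K, hK, eK⟩
    exact ⟨fun z => H z * K z, hH.mul hK, fun z => by simp [eH, eK]⟩
  algebraMap_mem' c := ⟨fun _ => c, contDiffOn_const, fun _ => rfl⟩

namespace smoothFunctions

section General

variable {E : Type*} [NormedAddCommGroup E] [NormedSpace ℝ E] {U : Opens E}

/-- The restriction to `U` of a function that is smooth on `U`. -/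
def restrict (H : E → ℝ) (hH : ContDiffOn ℝ ∞ H U) : smoothFunctions U :=
  ⟨fun z => H z, H, hH, fun _ => rfl⟩

/-- The extension by zero of a smooth function on `U` to the whole space. -/
noncomputable def zeroExt (h : smoothFunctions U) : E → ℝ := Function.extend Subtype.val h.1 0

theorem zeroExt_apply (h : smoothFunctions U) (z : U) : zeroExt h z = h.1 z :=
  Subtype.val_injective.extend_apply _ _ _

theorem zeroExt_of_notMem (h : smoothFunctions U) {z : E} (hz : z ∉ U) : zeroExt h z = 0 :=
  Function.extend_apply' _ _ _ (by rintro ⟨a, rfl⟩; exact hz a.2)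

theorem contDiffOn_zeroExt (h : smoothFunctions U) : ContDiffOn ℝ ∞ (zeroExt h) U := by
  obtain ⟨H, hH, e⟩ := h.2
  exact hH.congr fun z hz => by rw [zeroExt_apply h ⟨z, hz⟩, e]

theorem restrict_zeroExt (h : smoothFunctions U) : restrict _ (contDiffOn_zeroExt h) = h :=
  Subtype.ext (funext fun z => zeroExt_apply h z)

theorem differentiableAt_zeroExt (h : smoothFunctions U) (z : U) :
    DifferentiableAt ℝ (zeroExt h) z :=
  ((contDiffOn_zeroExt h).contDiffAt (U.isOpen.mem_nhds z.2)).differentiableAt (by simp)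

theorem eventuallyEq_zeroExt {h : smoothFunctions U} {H : E → ℝ} (e : ∀ z : U, h.1 z = H z)
    (z : U) : zeroExt h =ᶠ[nhds (z : E)] H :=
  Filter.eventuallyEq_of_mem (U.isOpen.mem_nhds z.2) fun y hy =>
    (zeroExt_apply h ⟨y, hy⟩).trans (e _)

/-- The derivation of the algebra of smooth functions defined by a smooth vector field. -/
noncomputable def derivAlong (w : E → E) (hw : ContDiffOn ℝ ∞ w U) :
    Derivation ℝ (smoothFunctions U) (smoothFunctions U) :=
  Derivation.mk'
    { toFun := fun h => restrict (fun z => fderiv ℝ (zeroExt h) z (w z))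
        (((contDiffOn_zeroExt h).fderiv_of_isOpen U.isOpen (by simp)).clm_apply hw)
      map_add' := fun h k => Subtype.ext (funext fun z => by
        change fderiv ℝ (zeroExt (h + k)) z (w z) =
          fderiv ℝ (zeroExt h) z (w z) + fderiv ℝ (zeroExt k) z (w z)
        rw [(eventuallyEq_zeroExt (h := h + k) (H := zeroExt h + zeroExt k)
          (fun y => by simp [zeroExt_apply]) z).fderiv_eq,
          fderiv_add (differentiableAt_zeroExt h z) (differentiableAt_zeroExt k z)]
        rfl)
      map_smul' := fun c h => Subtype.ext (funext fun z => by
        change fderiv ℝ (zeroExt (c • h)) z (w z) = c • fderiv ℝ (zeroExt h) z (w z)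
        rw [(eventuallyEq_zeroExt (h := c • h) (H := c • zeroExt h)
          (fun y => by simp [zeroExt_apply]) z).fderiv_eq,
          fderiv_const_smul (differentiableAt_zeroExt h z)]
        rfl) }
    (fun h k => Subtype.ext (funext fun z => by
        change fderiv ℝ (zeroExt (h * k)) z (w z) =
          h.1 z * fderiv ℝ (zeroExt k) z (w z) + k.1 z * fderiv ℝ (zeroExt h) z (w z)
        rw [(eventuallyEq_zeroExt (h := h * k) (H := zeroExt h * zeroExt k)
          (fun y => by simp [zeroExt_apply]) z).fderiv_eq,
          fderiv_mul (differentiableAt_zeroExt h z) (differentiableAt_zeroExt k z)]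
        simp [zeroExt_apply]))

theorem derivAlong_apply {w : E → E} (hw : ContDiffOn ℝ ∞ w U) {h : smoothFunctions U}
    {H : E → ℝ} (e : ∀ z : U, h.1 z = H z) (z : U) :
    (derivAlong w hw h).1 z = fderiv ℝ H z (w z) := by
  rw [← (eventuallyEq_zeroExt e z).fderiv_eq]
  rfl

/-- Symmetry of second derivatives. -/
theorem derivAlong_const_comm (e₁ e₂ : E) (h : smoothFunctions U) :
    derivAlong (fun _ => e₂) contDiffOn_const (derivAlong (fun _ => e₁) contDiffOn_const h) =
      derivAlong (fun _ => e₁) contDiffOn_const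
        (derivAlong (fun _ => e₂) contDiffOn_const h) := by
  refine Subtype.ext (funext fun z => ?_)
  have second : ∀ e e' : E, (derivAlong (U := U) (fun _ => e) contDiffOn_const
      (derivAlong (fun _ => e') contDiffOn_const h)).1 z =
      fderiv ℝ (fderiv ℝ (zeroExt h)) z e e' := fun e e' => by
    rw [derivAlong_apply _ (H := fun y => fderiv ℝ (zeroExt h) y e') fun y =>
      derivAlong_apply _ (fun y => (zeroExt_apply h y).symm) y]
    have hd : DifferentiableAt ℝ (fderiv ℝ (zeroExt h)) z :=
      (((contDiffOn_zeroExt h).fderiv_of_isOpen (m := ∞) U.isOpen (by simp)).contDiffAt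
        (U.isOpen.mem_nhds z.2)).differentiableAt (by simp)
    rw [fderiv_clm_apply hd (differentiableAt_const _)]
    simp
  rw [second, second]
  refine ((contDiffOn_zeroExt h).contDiffAt (U.isOpen.mem_nhds z.2)).isSymmSndFDerivAt ?_ _ _
  rw [minSmoothness_of_isRCLikeNormedField]
  simpa using (WithTop.coe_le_coe.2 le_top : ((2 : ℕ∞) : WithTop ℕ∞) ≤ ∞)

theorem isUnit_of_forall_ne_zero {h : smoothFunctions U} (hz : ∀ z, h.1 z ≠ 0) : IsUnit h := by
  refine IsUnit.of_mul_eq_one (restrict (fun z => (zeroExt h z)⁻¹)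
    ((contDiffOn_zeroExt h).inv fun z hz' => by rw [zeroExt_apply h ⟨z, hz'⟩]; exact hz _)) ?_
  refine Subtype.ext (funext fun z => ?_)
  change h.1 z * (zeroExt h z)⁻¹ = 1
  rw [zeroExt_apply, mul_inv_cancel₀ (hz z)]

theorem ne_zero_of_isUnit {h : smoothFunctions U} (hu : IsUnit h) (z : U) : h.1 z ≠ 0 := by
  obtain ⟨i, hi⟩ := hu.exists_left_inv
  have : i.1 z * h.1 z = 1 := congrFun (congrArg Subtype.val hi) z
  exact right_ne_zero_of_mul_eq_one this

theorem eq_zero_of_mul_self {h : smoothFunctions U} (e : h * h = 0) : h = 0 := by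
  refine Subtype.ext (funext fun z => ?_)
  exact mul_self_eq_zero.1 (congrFun (congrArg Subtype.val e) z)

end General

section Plane

variable {V : Opens (ℝ × ℝ)}

variable (V) in
/-- The derivation `∂/∂ξ`. -/
noncomputable def dFst : Derivation ℝ (smoothFunctions V) (smoothFunctions V) :=
  derivAlong (fun _ => (1, 0)) contDiffOn_const

variable (V) in
/-- The derivation `∂/∂w`. -/
noncomputable def dSnd : Derivation ℝ (smoothFunctions V) (smoothFunctions V) :=
  derivAlong (fun _ => (0, 1)) contDiffOn_const

theorem dSnd_dFst (h : smoothFunctions V) : dSnd V (dFst V h) = dFst V (dSnd V h) :=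
  derivAlong_const_comm _ _ h

theorem fderiv_eq_dFst_dSnd {h : smoothFunctions V} {H : ℝ × ℝ → ℝ} (e : ∀ z : V, h.1 z = H z)
    (z : V) (t : ℝ × ℝ) :
    fderiv ℝ H z t = t.1 * (dFst V h).1 z + t.2 * (dSnd V h).1 z := by
  rw [dFst, dSnd, derivAlong_apply _ e, derivAlong_apply _ e, ← smul_eq_mul, ← smul_eq_mul,
    ← map_smul, ← map_smul, ← map_add]
  simp

theorem exists_eq_algebraMap (hV : IsPreconnected (V : Set (ℝ × ℝ))) {h : smoothFunctions V}
    (h₁ : dFst V h = 0) (h₂ : dSnd V h = 0) :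
    ∃ c : ℝ, h = algebraMap ℝ (smoothFunctions V) c := by
  obtain ⟨c, hc⟩ := V.isOpen.exists_is_const_of_fderiv_eq_zero hV (f := zeroExt h) (𝕜 := ℝ)
    ((contDiffOn_zeroExt h).differentiableOn (by simp)) (fun z hz => by
      ext1 <;> ext1 <;>
      simp [fderiv_eq_dFst_dSnd (fun z => (zeroExt_apply h z).symm) ⟨z, hz⟩, h₁, h₂])
  exact ⟨c, Subtype.ext (funext fun z => by
    rw [← zeroExt_apply]; exact hc z z.2)⟩

end Plane

section Jets

/-- The first-order jets over an open subset of the plane. -/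
def jets (V : Opens (ℝ × ℝ)) : Opens ((ℝ × ℝ) × ℝ) :=
  ⟨Prod.fst ⁻¹' V, V.isOpen.preimage continuous_fst⟩

variable {V : Opens (ℝ × ℝ)}

theorem mapsTo_fst_jets : Set.MapsTo Prod.fst (jets V : Set ((ℝ × ℝ) × ℝ)) (V : Set (ℝ × ℝ)) :=
  fun _ hj => hj

/-- A smooth function of `(ξ, w)`, regarded as a function of first-order jets. -/
noncomputable def liftJets (V : Opens (ℝ × ℝ)) :
    smoothFunctions V →ₐ[ℝ] smoothFunctions (jets V) where
  toFun h := ⟨fun j => h.1 ⟨j.1.1, j.2⟩, fun j => zeroExt h j.1,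
    (contDiffOn_zeroExt h).comp contDiffOn_fst mapsTo_fst_jets,
    fun j => (zeroExt_apply h ⟨j.1.1, j.2⟩).symm⟩
  map_one' := rfl
  map_mul' _ _ := rfl
  map_zero' := rfl
  map_add' _ _ := rfl
  commutes' _ := rfl

variable (V) in
/-- The jet coordinate `w_ξ`. -/
noncomputable def slope : smoothFunctions (jets V) := restrict Prod.snd contDiffOn_snd

theorem derivAlong_liftJets {w : (ℝ × ℝ) × ℝ → (ℝ × ℝ) × ℝ} (hw : ContDiffOn ℝ ∞ w (jets V))
    (h : smoothFunctions V) (j : jets V) :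
    (derivAlong w hw (liftJets V h)).1 j =
      (w j).1.1 * (liftJets V (dFst V h)).1 j + (w j).1.2 * (liftJets V (dSnd V h)).1 j := by
  rw [derivAlong_apply hw (h := liftJets V h) (H := zeroExt h ∘ Prod.fst) fun j =>
      (zeroExt_apply h ⟨j.1.1, j.2⟩).symm,
    fderiv_comp _ (show DifferentiableAt ℝ (zeroExt h) j.1.1 from
      differentiableAt_zeroExt h ⟨j.1.1, j.2⟩) differentiableAt_fst, fderiv_fst]
  exact fderiv_eq_dFst_dSnd (fun z => (zeroExt_apply h z).symm) ⟨j.1.1, j.2⟩ _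

theorem derivAlong_slope {w : (ℝ × ℝ) × ℝ → (ℝ × ℝ) × ℝ} (hw : ContDiffOn ℝ ∞ w (jets V))
    (j : jets V) : (derivAlong w hw (slope V)).1 j = (w j).2 := by
  rw [derivAlong_apply hw (h := slope V) (H := Prod.snd) fun _ => rfl, fderiv_snd]
  rfl

end Jets

end smoothFunctions

/-! ### Total derivatives and the transformed equation -/

namespace smoothFunctions

variable {V : Opens (ℝ × ℝ)}

/-- The total derivative `∂_ξ + w_ξ ∂_w + c ∂_{w_ξ}` on functions of first-order jets, where the
smooth function `c` takes the place of `w_ξξ`. -/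
noncomputable def totalD (c : smoothFunctions (jets V)) :
    Derivation ℝ (smoothFunctions (jets V)) (smoothFunctions (jets V)) :=
  derivAlong (fun j => ((1, j.2), zeroExt c j))
    ((contDiffOn_const.prodMk contDiffOn_snd).prodMk (contDiffOn_zeroExt c))

theorem totalD_liftJets (c : smoothFunctions (jets V)) (h : smoothFunctions V) :
    totalD c (liftJets V h) = liftJets V (dFst V h) + slope V * liftJets V (dSnd V h) := by
  refine Subtype.ext (funext fun j => ?_)
  rw [totalD, derivAlong_liftJets]
  simp only [one_mul]
  rfl

theorem totalD_slope (c : smoothFunctions (jets V)) : totalD c (slope V) = c := by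
  refine Subtype.ext (funext fun j => ?_)
  rw [totalD, derivAlong_slope]
  exact zeroExt_apply c j

theorem totalD_totalD_liftJets (c c' : smoothFunctions (jets V)) (h : smoothFunctions V) :
    totalD c (totalD c' (liftJets V h)) =
      totalD 0 (totalD 0 (liftJets V h)) + c * liftJets V (dSnd V h) := by
  simp only [totalD_liftJets, map_add, Derivation.leibniz, smul_eq_mul, totalD_slope]
  ring

theorem totalD_apply (c : smoothFunctions (jets V)) {h : smoothFunctions (jets V)}
    {H : (ℝ × ℝ) × ℝ → ℝ} (e : ∀ j : jets V, h.1 j = H j) (j : jets V) :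
    (totalD c h).1 j = totalDerivJet H j (c.1 j) := by
  rw [totalD, derivAlong_apply _ e, zeroExt_apply, totalDerivJet]

theorem totalDeriv_eq {h : smoothFunctions V} {H : ℝ × ℝ → ℝ} (e : ∀ z : V, h.1 z = H z)
    (c : smoothFunctions (jets V)) (j : jets V) :
    (totalD c (liftJets V h)).1 j = totalDeriv H j := by
  rw [totalD_liftJets, totalDeriv, fderiv_eq_dFst_dSnd e ⟨j.1.1, j.2⟩, one_mul]
  rfl

theorem continuous_slice (h : smoothFunctions (jets V)) {z : ℝ × ℝ} (hz : z ∈ V) :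
    Continuous fun p : ℝ => h.1 ⟨(z, p), hz⟩ := by
  have := (contDiffOn_zeroExt h).continuousOn.comp_continuous
    (f := fun p : ℝ => (z, p)) (by fun_prop) (fun p => hz)
  exact this.congr fun p => zeroExt_apply h ⟨(z, p), hz⟩

/-- The quotient rule for `y_xx`, cleared of denominators:
`(DG)³ y_xx = DG · D(DF) - DF · D(DG)`. -/
theorem newSecondDeriv_mul {x y : smoothFunctions V} {F G : ℝ × ℝ → ℝ}
    (hx : ∀ z : V, x.1 z = G z) (hy : ∀ z : V, y.1 z = F z) (c : smoothFunctions (jets V))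
    (j : jets V) (hT : totalDeriv G j ≠ 0) :
    newSecondDeriv F G j (c.1 j) * totalDeriv G j ^ 3 =
      (totalD c (liftJets V x) * totalD c (totalD c (liftJets V y)) -
        totalD c (liftJets V y) * totalD c (totalD c (liftJets V x))).1 j := by
  change _ = (totalD c (liftJets V x)).1 j * (totalD c (totalD c (liftJets V y))).1 j -
    (totalD c (liftJets V y)).1 j * (totalD c (totalD c (liftJets V x))).1 j
  rw [totalD_apply c (totalDeriv_eq hx c), totalD_apply c (totalDeriv_eq hy c),
    totalDeriv_eq hx, totalDeriv_eq hy, newSecondDeriv]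
  have diff : ∀ {h : smoothFunctions V} {H : ℝ × ℝ → ℝ}, (∀ z : V, h.1 z = H z) →
      DifferentiableAt ℝ (totalDeriv H) j := fun e =>
    (differentiableAt_zeroExt _ j).congr_of_eventuallyEq
      (eventuallyEq_zeroExt (totalDeriv_eq e c) j).symm
  have dP : DifferentiableAt ℝ (newFirstDeriv F G) j := by
    change DifferentiableAt ℝ (fun k => totalDeriv F k / totalDeriv G k) j
    simp only [div_eq_mul_inv]
    exact (diff hy).mul ((diff hx).inv hT)
  have hmul : (newFirstDeriv F G * totalDeriv G) =ᶠ[nhds (j : (ℝ × ℝ) × ℝ)] totalDeriv F := by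
    filter_upwards [(diff hx).continuousAt.eventually_ne hT] with k hk
    exact div_mul_cancel₀ _ hk
  have hF : totalDerivJet (totalDeriv F) j (c.1 j) =
      newFirstDeriv F G j * totalDerivJet (totalDeriv G) j (c.1 j) +
        totalDeriv G j * totalDerivJet (newFirstDeriv F G) j (c.1 j) := by
    unfold totalDerivJet
    rw [← hmul.fderiv_eq, fderiv_mul dP (diff hx)]
    rfl
  have hP : newFirstDeriv F G j * totalDeriv G j = totalDeriv F j := div_mul_cancel₀ _ hT
  rw [hF, ← hP]
  field_simp
  ring

/-- If `w_ξξ = Ω₁` is equivalent to `y_xx = r`, where `r` does not depend on `y_x`, and `Ω₁` is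
continuous in `w_ξ`, then `Ω₁` is smooth, and the cleared form of the transformed equation holds at
all jets, including the excluded ones with `DG = 0`. -/
theorem transformed_equation {x y r : smoothFunctions V} {Ω₁ Ω₂ : (ℝ × ℝ) × ℝ → ℝ}
    {F G : ℝ × ℝ → ℝ} (hx : ∀ z : V, x.1 z = G z) (hy : ∀ z : V, y.1 z = F z)
    (hr : ∀ (z : V) (p : ℝ), r.1 z = Ω₂ ((G z, F z), p))
    (hJ : IsUnit (dFst V x * dSnd V y - dSnd V x * dFst V y))
    (hΩ : ∀ z, Continuous fun p => Ω₁ (z, p)) (h : IsPointEquivalence Ω₁ Ω₂ V F G) :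
    ∃ c : smoothFunctions (jets V), (∀ j : jets V, c.1 j = Ω₁ j) ∧
      totalD c (liftJets V x) * totalD c (totalD c (liftJets V y)) -
        totalD c (liftJets V y) * totalD c (totalD c (liftJets V x)) =
      liftJets V r * totalD c (liftJets V x) ^ 3 := by
  set T := totalD 0 (liftJets V x) with hTdef
  set S := totalD 0 (liftJets V y) with hSdef
  set J := dFst V x * dSnd V y - dSnd V x * dFst V y with hJdef
  have hD : ∀ c h, totalD c (liftJets V h) = totalD 0 (liftJets V h) := fun c h => by
    rw [totalD_liftJets, totalD_liftJets]
  have hJ' : liftJets V J = T * liftJets V (dSnd V y) - S * liftJets V (dSnd V x) := by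
    simp only [hTdef, hSdef, hJdef, totalD_liftJets, map_sub, map_mul]; ring
  set N := liftJets V r * T ^ 3 - T * totalD 0 S + S * totalD 0 T with hN
  have eqn : ∀ c, totalD c (liftJets V x) * totalD c (totalD c (liftJets V y)) -
      totalD c (liftJets V y) * totalD c (totalD c (liftJets V x)) -
      liftJets V r * totalD c (liftJets V x) ^ 3 = liftJets V J * c - N := fun c => by
    rw [totalD_totalD_liftJets c c y, totalD_totalD_liftJets c c x, hD c x, hD c y,
      ← hTdef, ← hSdef, hJ', hN]
    ring
  have generic : ∀ j : jets V, T.1 j ≠ 0 → (liftJets V J).1 j * Ω₁ j = N.1 j := fun j hTj => by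
    have hT : totalDeriv G j ≠ 0 := by rwa [← totalDeriv_eq hx 0]
    -- smoothness of `Ω₁` is not yet known, so `w_ξξ` is extended from `j` as a constant
    set c := algebraMap ℝ (smoothFunctions (jets V)) (Ω₁ j)
    have hc : c.1 j = Ω₁ j := rfl
    have e := newSecondDeriv_mul hx hy c j hT
    rw [hc, (h.maps_equation j.1.1 j.2 j.1.2 _ hT).2 rfl, ← hr ⟨j.1.1, j.2⟩,
      ← totalDeriv_eq hx c] at e
    have e' := congrFun (congrArg Subtype.val (eqn c)) j
    change (_ : ℝ) - (liftJets V r).1 j * (totalD c (liftJets V x)).1 j ^ 3 =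
      (liftJets V J).1 j * c.1 j - N.1 j at e'
    rw [hc] at e'
    have e'' : (liftJets V r).1 j * (totalD c (liftJets V x)).1 j ^ 3 = _ := e
    rw [e''] at e'
    have := e'.symm.trans (sub_self _)
    linarith
  have all : ∀ j : jets V, (liftJets V J).1 j * Ω₁ j = N.1 j := by
    rintro ⟨⟨z, p⟩, hz⟩
    -- `DG` is affine in `w_ξ`, and not identically zero since the Jacobian does not vanish
    have dense : Dense {p : ℝ | T.1 ⟨(z, p), hz⟩ ≠ 0} := by
      refine (Set.Subsingleton.countable ?_ :
        {p : ℝ | T.1 ⟨(z, p), hz⟩ = 0}.Countable).dense_compl ℝ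
      have hT : ∀ p, T.1 ⟨(z, p), hz⟩ = (dFst V x).1 ⟨z, hz⟩ + p * (dSnd V x).1 ⟨z, hz⟩ :=
        fun p => by rw [hTdef, totalD_liftJets]; rfl
      have hJz : (dFst V x).1 ⟨z, hz⟩ * (dSnd V y).1 ⟨z, hz⟩ -
          (dSnd V x).1 ⟨z, hz⟩ * (dFst V y).1 ⟨z, hz⟩ ≠ 0 := ne_zero_of_isUnit hJ ⟨z, hz⟩
      intro p hp q hq
      rw [Set.mem_ofPred_eq, hT] at hp hq
      by_contra hpq
      have h2 : (dSnd V x).1 ⟨z, hz⟩ = 0 :=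
        (mul_eq_zero.1 (show (p - q) * (dSnd V x).1 ⟨z, hz⟩ = 0 by linarith)).resolve_left
          (sub_ne_zero.2 hpq)
      rw [h2] at hp hJz
      apply hJz
      rw [show (dFst V x).1 ⟨z, hz⟩ = 0 by linarith]
      ring
    have hcont : Continuous fun p : ℝ => (liftJets V J).1 ⟨(z, p), hz⟩ * Ω₁ (z, p) :=
      (continuous_slice _ hz).mul (hΩ z)
    exact congrFun (hcont.ext_on dense (continuous_slice N hz)
      fun p hp => generic ⟨(z, p), hz⟩ hp) p
  obtain ⟨i, hi⟩ := hJ.exists_left_inv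
  have hi' : liftJets V i * liftJets V J = 1 := by rw [← map_mul, hi, map_one]
  refine ⟨liftJets V i * N, fun j => ?_, ?_⟩
  · have : (liftJets V i).1 j * (liftJets V J).1 j = 1 := congrFun (congrArg Subtype.val hi') j
    rw [Subalgebra.coe_mul, Pi.mul_apply, ← all j, ← mul_assoc, this, one_mul]
  · rw [← sub_eq_zero, eqn]
    linear_combination N * hi'

end smoothFunctions

/-! ### Vector fields as derivations, and the symmetry condition -/

namespace SmoothVectorFields

open smoothFunctions

variable {V : Opens (ℝ × ℝ)}

/-- The coefficient of `∂/∂ξ`. -/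
noncomputable def fst : SmoothVectorFields V →ₗ[ℝ] smoothFunctions V where
  toFun v := restrict (fun z => (v.1 z).1) v.2.1.fst
  map_add' _ _ := rfl
  map_smul' _ _ := rfl

/-- The coefficient of `∂/∂w`. -/
noncomputable def snd : SmoothVectorFields V →ₗ[ℝ] smoothFunctions V where
  toFun v := restrict (fun z => (v.1 z).2) v.2.1.snd
  map_add' _ _ := rfl
  map_smul' _ _ := rfl

/-- The vector field with given coefficients. -/
noncomputable def ofCoeffs (a b : smoothFunctions V) : SmoothVectorFields V :=
  ⟨fun z => (zeroExt a z, zeroExt b z), (contDiffOn_zeroExt a).prodMk (contDiffOn_zeroExt b),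
    fun z hz => by
      change (zeroExt a z, zeroExt b z) = 0
      rw [zeroExt_of_notMem a hz, zeroExt_of_notMem b hz]; rfl⟩

theorem fst_ofCoeffs (a b : smoothFunctions V) : fst (ofCoeffs a b) = a := restrict_zeroExt a

theorem snd_ofCoeffs (a b : smoothFunctions V) : snd (ofCoeffs a b) = b := restrict_zeroExt b

theorem ext_coeffs {v w : SmoothVectorFields V} (h₁ : fst v = fst w) (h₂ : snd v = snd w) :
    v = w :=
  ext_on fun z hz => Prod.ext (congrFun (congrArg Subtype.val h₁) ⟨z, hz⟩)
    (congrFun (congrArg Subtype.val h₂) ⟨z, hz⟩)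

/-- The derivative of a smooth function along a vector field. -/
noncomputable def apply (h : smoothFunctions V) :
    SmoothVectorFields V →ₗ[ℝ] smoothFunctions V where
  toFun v := fst v * dFst V h + snd v * dSnd V h
  map_add' v w := by rw [map_add, map_add]; ring
  map_smul' c v := by simp

theorem apply_eq (h : smoothFunctions V) (v : SmoothVectorFields V) :
    apply h v = fst v * dFst V h + snd v * dSnd V h := rfl

theorem fst_bracket (v w : SmoothVectorFields V) :
    fst ⁅v, w⁆ = apply (fst w) v - apply (fst v) w := by
  refine Subtype.ext (funext fun z => ?_)
  have hd := fun u : SmoothVectorFields V => fderiv.fst (differentiableAt u z.2)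
  have e := fun u : SmoothVectorFields V => fderiv_eq_dFst_dSnd (h := fst u)
    (H := fun z => (u.1 z).1) (fun _ => rfl) z
  change (VectorField.lieBracket ℝ v.1 w.1 z).1 = _
  rw [VectorField.lieBracket_eq]
  change (fderiv ℝ w.1 z (v.1 z)).1 - (fderiv ℝ v.1 z (w.1 z)).1 = _
  have e₁ := e w (v.1 z)
  have e₂ := e v (w.1 z)
  rw [hd] at e₁ e₂
  exact congrArg₂ (· - ·) e₁ e₂

theorem snd_bracket (v w : SmoothVectorFields V) :
    snd ⁅v, w⁆ = apply (snd w) v - apply (snd v) w := by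
  refine Subtype.ext (funext fun z => ?_)
  have hd := fun u : SmoothVectorFields V => fderiv.snd (differentiableAt u z.2)
  have e := fun u : SmoothVectorFields V => fderiv_eq_dFst_dSnd (h := snd u)
    (H := fun z => (u.1 z).2) (fun _ => rfl) z
  change (VectorField.lieBracket ℝ v.1 w.1 z).2 = _
  rw [VectorField.lieBracket_eq]
  change (fderiv ℝ w.1 z (v.1 z)).2 - (fderiv ℝ v.1 z (w.1 z)).2 = _
  have e₁ := e w (v.1 z)
  have e₂ := e v (w.1 z)
  rw [hd] at e₁ e₂
  exact congrArg₂ (· - ·) e₁ e₂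

theorem apply_bracket (h : smoothFunctions V) (v w : SmoothVectorFields V) :
    apply h ⁅v, w⁆ = apply (apply h w) v - apply (apply h v) w := by
  simp only [apply_eq, fst_bracket, snd_bracket, map_add, Derivation.leibniz, smul_eq_mul,
    dSnd_dFst]
  ring

/-- With `U` the first prolongation of `v` and `D` the total derivative along `w_ξξ = Ω`, the
symmetry condition says that `[U, D] + (D a) D` vanishes on the jet coordinate `w_ξ`. -/
theorem isPointSymmetry_iff_defect {Ω : (ℝ × ℝ) × ℝ → ℝ} {c : smoothFunctions (jets V)}
    (hc : ∀ j : jets V, c.1 j = Ω j) (v : SmoothVectorFields V) :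
    ∃ U : Derivation ℝ (smoothFunctions (jets V)) (smoothFunctions (jets V)),
      (∀ h, U (liftJets V h) = liftJets V (fst v * dFst V h + snd v * dSnd V h)) ∧
      U (slope V) = totalD c (liftJets V (snd v)) - slope V * totalD c (liftJets V (fst v)) ∧
      (IsPointSymmetry Ω V v.1 ↔ U (totalD c (slope V)) - totalD c (U (slope V)) +
        totalD c (liftJets V (fst v)) * totalD c (slope V) = 0) := by
  set q := totalD c (liftJets V (snd v)) - slope V * totalD c (liftJets V (fst v)) with hq
  set U : Derivation ℝ (smoothFunctions (jets V)) (smoothFunctions (jets V)) :=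
    derivAlong (fun j => (v.1 j.1, zeroExt q j))
      ((v.2.1.comp contDiffOn_fst mapsTo_fst_jets).prodMk (contDiffOn_zeroExt q)) with hU
  have hUs : U (slope V) = q := by
    refine Subtype.ext (funext fun j => ?_)
    rw [hU, derivAlong_slope]
    exact zeroExt_apply q j
  have hfst : ∀ j : jets V, (totalD c (liftJets V (fst v))).1 j =
      totalDeriv (fun z => (v.1 z).1) j := totalDeriv_eq (fun _ => rfl) c
  have hq' : ∀ j : jets V, q.1 j = prolongOne v.1 j := fun j => by
    rw [prolongOne, ← totalDeriv_eq (h := snd v) (fun _ => rfl) c, ← hfst]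
    rfl
  refine ⟨U, fun h => ?_, hUs, ?_⟩
  · refine Subtype.ext (funext fun j => ?_)
    rw [hU, derivAlong_liftJets]
    rfl
  · rw [hUs, totalD_slope]
    have value : ∀ j : jets V, (U c - totalD c q + totalD c (liftJets V (fst v)) * c).1 j =
        fderiv ℝ Ω j (v.1 j.1.1, prolongOne v.1 j) - prolongTwo v.1 j (Ω j) := fun j => by
      change (U c).1 j - (totalD c q).1 j + (totalD c (liftJets V (fst v))).1 j * c.1 j = _
      rw [totalD_apply c hq', hfst, hc, hU, derivAlong_apply _ hc, zeroExt_apply, hq', prolongTwo]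
      ring
    constructor
    · intro h
      refine Subtype.ext (funext fun j => (value j).trans ?_)
      exact sub_eq_zero.2 (h j.1.1 j.2 j.1.2).symm
    · intro h z hz p
      have := (value ⟨(z, p), hz⟩).symm.trans (congrFun (congrArg Subtype.val h) ⟨(z, p), hz⟩)
      exact (sub_eq_zero.1 this).symm

/-- The symmetry condition for `w_ξξ = Ω`, expressed in the coordinates `x`, `y` in which the
equation reads `y_xx = r`. -/
theorem isPointSymmetry_iff {Ω : (ℝ × ℝ) × ℝ → ℝ} {c : smoothFunctions (jets V)}
    (hc : ∀ j : jets V, c.1 j = Ω j) {x y r : smoothFunctions V}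
    (hJ : IsUnit (dFst V x * dSnd V y - dSnd V x * dFst V y))
    (hr : totalD c (liftJets V x) * totalD c (totalD c (liftJets V y)) -
        totalD c (liftJets V y) * totalD c (totalD c (liftJets V x)) =
      liftJets V r * totalD c (liftJets V x) ^ 3)
    {X Y : Derivation ℝ (smoothFunctions V) (smoothFunctions V)}
    (h₁ : ∀ h, dFst V h = dFst V x * X h + dFst V y * Y h)
    (h₂ : ∀ h, dSnd V h = dSnd V x * X h + dSnd V y * Y h) (v : SmoothVectorFields V) :
    IsPointSymmetry Ω V v.1 ↔
      apply x v * X r + apply y v * Y r + 2 * r * X (apply x v) - r * Y (apply y v) -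
        X (X (apply y v)) = 0 ∧
      3 * r * Y (apply x v) - 2 * X (Y (apply y v)) + X (X (apply x v)) = 0 ∧
      2 * X (Y (apply x v)) - Y (Y (apply y v)) = 0 ∧
      Y (Y (apply x v)) = 0 := by
  obtain ⟨U, hU, hUp, hsym⟩ := isPointSymmetry_iff_defect hc v
  have key := prolongation_defect_eq (dFst V) (dSnd V) dSnd_dFst (liftJets V) (totalD c) U
    (slope V) _ _
    (totalD_liftJets c) hU hUp X Y
    (dual_derivations_commute _ _ X Y dSnd_dFst x y hJ h₁ h₂) x y r _ _ h₁ h₂ rfl rfl hr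
  rw [← apply_eq, ← apply_eq] at key
  have hJ' := hJ.map (liftJets V)
  rw [hsym, ← hJ'.mul_right_eq_zero, key]
  clear key hr
  generalize apply x v * X r + apply y v * Y r + 2 * r * X (apply x v) - r * Y (apply y v) -
    X (X (apply y v)) = e₀
  generalize 3 * r * Y (apply x v) - 2 * X (Y (apply y v)) + X (X (apply x v)) = e₁
  generalize 2 * X (Y (apply x v)) - Y (Y (apply y v)) = e₂
  generalize Y (Y (apply x v)) = e₃
  constructor
  · intro h
    have pointwise : ∀ z : V, e₀.1 z = 0 ∧ e₁.1 z = 0 ∧ e₂.1 z = 0 ∧ e₃.1 z = 0 := fun z => by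
      refine cubic_form_eq_zero (t₀ := (dFst V x).1 z) (t₁ := (dSnd V x).1 z)
        (s₀ := (dFst V y).1 z) (s₁ := (dSnd V y).1 z) ?_ fun p => ?_
      · exact ne_zero_of_isUnit hJ z
      · rw [totalD_liftJets, totalD_liftJets] at h
        exact congrFun (congrArg Subtype.val h) ⟨(z, p), z.2⟩
    exact ⟨Subtype.ext (funext fun z => (pointwise z).1),
      Subtype.ext (funext fun z => (pointwise z).2.1),
      Subtype.ext (funext fun z => (pointwise z).2.2.1),
      Subtype.ext (funext fun z => (pointwise z).2.2.2)⟩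
  · rintro ⟨rfl, rfl, rfl, rfl⟩
    simp

end SmoothVectorFields

/-! ### The symmetry algebra -/

namespace SmoothVectorFields

open smoothFunctions

variable {V : Opens (ℝ × ℝ)}

theorem hasPointSymmetryAlgebraOfDim_of_range {M : Type*} [AddCommGroup M] [Module ℝ M]
    [Module.Finite ℝ M] {Ω : (ℝ × ℝ) × ℝ → ℝ} (Θ : M →ₗ[ℝ] SmoothVectorFields V)
    (hinj : Function.Injective Θ)
    (hrange : ∀ v : SmoothVectorFields V, IsPointSymmetry Ω V v.1 ↔ ∃ c, Θ c = v)
    (hlie : ∀ c c', ∃ c'', Θ c'' = ⁅Θ c, Θ c'⁆) :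
    HasPointSymmetryAlgebraOfDim Ω V (Module.finrank ℝ M) := by
  let L : LieSubalgebra ℝ (SmoothVectorFields V) :=
    { LinearMap.range Θ with
      lie_mem' := by
        rintro _ _ ⟨c, rfl⟩ ⟨c', rfl⟩
        exact hlie c c' }
  exact ⟨L, fun v => (hrange v).symm, Module.Finite.range Θ,
    LinearMap.finrank_range_of_inj hinj⟩

/-- A vector field is determined by its coefficients with respect to `∂_x`, `∂_y`, which may be
prescribed. -/
theorem exists_frame_equiv {x y : smoothFunctions V}
    (hJ : IsUnit (dFst V x * dSnd V y - dSnd V x * dFst V y)) :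
    ∃ e : SmoothVectorFields V ≃ₗ[ℝ] smoothFunctions V × smoothFunctions V,
      ∀ v, e v = (apply x v, apply y v) := by
  obtain ⟨i, hi⟩ := hJ.exists_left_inv
  refine ⟨LinearEquiv.ofBijective ((apply x).prod (apply y)) ⟨?_, ?_⟩, fun v => rfl⟩
  · rw [injective_iff_map_eq_zero]
    intro v hv
    have e₁ : fst v * dFst V x + snd v * dSnd V x = 0 := congrArg Prod.fst hv
    have e₂ : fst v * dFst V y + snd v * dSnd V y = 0 := congrArg Prod.snd hv
    refine ext_coeffs ?_ ?_ <;> rw [map_zero]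
    · linear_combination (i * dSnd V y) * e₁ - (i * dSnd V x) * e₂ - fst v * hi
    · linear_combination (i * dFst V x) * e₂ - (i * dFst V y) * e₁ - snd v * hi
  · rintro ⟨α, β⟩
    refine ⟨ofCoeffs (i * (α * dSnd V y - β * dSnd V x)) (i * (β * dFst V x - α * dFst V y)),
      Prod.ext ?_ ?_⟩
    · change apply x _ = α
      rw [apply_eq, fst_ofCoeffs, snd_ofCoeffs]
      linear_combination α * hi
    · change apply y _ = β
      rw [apply_eq, fst_ofCoeffs, snd_ofCoeffs]
      linear_combination β * hi

theorem frame_bracket {x y : smoothFunctions V}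
    {X Y : Derivation ℝ (smoothFunctions V) (smoothFunctions V)}
    (h₁ : ∀ h, dFst V h = dFst V x * X h + dFst V y * Y h)
    (h₂ : ∀ h, dSnd V h = dSnd V x * X h + dSnd V y * Y h)
    (hXx : X x = 1) (hYx : Y x = 0) (hXy : X y = 0) (hYy : Y y = 1) (k : ℝ)
    {v w : SmoothVectorFields V} {c c' : ℝ × ℝ × ℝ}
    (hv : quadraticPair k x y c = (apply x v, apply y v))
    (hw : quadraticPair k x y c' = (apply x w, apply y w)) :
    quadraticPair k x y (c.1 * c'.2.1 - c.2.1 * c'.1, 2 * (c.1 * c'.2.2 - c.2.2 * c'.1),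
      c.2.1 * c'.2.2 - c.2.2 * c'.2.1) = (apply x ⁅v, w⁆, apply y ⁅v, w⁆) := by
  have happly : ∀ h u, apply h u = apply x u * X h + apply y u * Y h := fun h u => by
    rw [apply_eq, apply_eq, apply_eq, h₁ h, h₂ h]; ring
  rw [apply_bracket, apply_bracket, happly (apply x w), happly (apply x v), happly (apply y w),
    happly (apply y v)]
  obtain ⟨v₁, v₂⟩ := Prod.ext_iff.1 hv
  obtain ⟨w₁, w₂⟩ := Prod.ext_iff.1 hw
  dsimp only at v₁ v₂ w₁ w₂
  rw [← v₁, ← v₂, ← w₁, ← w₂]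
  exact quadraticPair_bracket X Y k hXx hYx hXy hYy c c'

end SmoothVectorFields

open smoothFunctions SmoothVectorFields in
theorem mainTheorem9 (n δ : ℝ) (hn0 : n ≠ 0) (hn1 : n ≠ 1) (hδ : δ ≠ 0)
    (f g : ℝ → ℝ) (V : Opens (ℝ × ℝ)) (hV : IsConnected (V : Set (ℝ × ℝ)))
    (F G : ℝ × ℝ → ℝ) (hF : ∀ z ∈ V, PowerRegularAt n (F z))
    (h : IsPointEquivalence (lienard f g) (anharmonic δ n) V F G) :
    (n ≠ -3 → HasPointSymmetryAlgebraOfDim (lienard f g) V 2) ∧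
    (n = -3 → HasPointSymmetryAlgebraOfDim (lienard f g) V 3) := by
  have : Nonempty V := hV.nonempty.to_subtype
  have hpow : ∀ {m : ℝ}, (∀ z ∈ V, PowerRegularAt m (F z)) →
      ContDiffOn ℝ ∞ (fun z => F z ^ m) V := fun hm z hz =>
    ((hm z hz).contDiffAt.comp z (h.smooth_F.contDiffAt (V.isOpen.mem_nhds hz))).contDiffWithinAt
  -- also where `F = 0`: there `n` is a positive integer, so `n - 1` is a natural number
  have hF' : ∀ z ∈ V, PowerRegularAt (n - 1) (F z) := fun z hz => (hF z hz).sub_one hn0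
  set x : smoothFunctions V := restrict G h.smooth_G with hx
  set y : smoothFunctions V := restrict F h.smooth_F with hy
  set u : smoothFunctions V := restrict _ (hpow hF) with hu
  set u' : smoothFunctions V := restrict _ (hpow hF') with hu'
  have hJ : IsUnit (dFst V x * dSnd V y - dSnd V x * dFst V y) := by
    refine isUnit_of_forall_ne_zero fun z => ?_
    have := h.jacobian_ne_zero z z.2
    rw [fderiv_eq_dFst_dSnd (h := x) (fun _ => rfl), fderiv_eq_dFst_dSnd (h := x) (fun _ => rfl),
      fderiv_eq_dFst_dSnd (h := y) (fun _ => rfl), fderiv_eq_dFst_dSnd (h := y) (fun _ => rfl)]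
      at this
    simpa using this
  have hdu : ∀ (e : ℝ × ℝ) (z : V), fderiv ℝ (fun z => F z ^ n) z e =
      n * F z ^ (n - 1) * fderiv ℝ F z e := fun e z => by
    have d₁ := ((hF z z.2).contDiffAt.differentiableAt (by simp)).hasDerivAt
    rw [Real.deriv_rpow_const] at d₁
    have d₂ := ((h.smooth_F.contDiffAt (V.isOpen.mem_nhds z.2)).differentiableAt
      (by simp)).hasFDerivAt
    have := (d₁.comp_hasFDerivAt (z : ℝ × ℝ) d₂).fderiv
    change fderiv ℝ (fun z => F z ^ n) z = _ at this
    rw [this]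
    rfl
  have hu₁ : dFst V u = algebraMap ℝ _ n * u' * dFst V y := Subtype.ext (funext fun z => by
    rw [dFst, derivAlong_apply (h := u) (H := fun z => F z ^ n) _ (fun _ => rfl), hdu,
      ← derivAlong_apply (h := y) contDiffOn_const (fun _ => rfl) z]
    rfl)
  have hu₂ : dSnd V u = algebraMap ℝ _ n * u' * dSnd V y := Subtype.ext (funext fun z => by
    rw [dSnd, derivAlong_apply (h := u) (H := fun z => F z ^ n) _ (fun _ => rfl), hdu,
      ← derivAlong_apply (h := y) contDiffOn_const (fun _ => rfl) z]
    rfl)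
  obtain ⟨X, Y, h₁, h₂, hXx, hXy, hYx, hYy⟩ := exists_dual_derivations (dFst V) (dSnd V) x y hJ
  have hXu : X u = 0 := hJ.mul_left_cancel (by
    linear_combination dSnd V y * (hu₁ - h₁ u) - dFst V y * (hu₂ - h₂ u))
  have hYu : Y u = algebraMap ℝ _ n * u' := hJ.mul_left_cancel (by
    linear_combination dFst V x * (hu₂ - h₂ u) - dSnd V x * (hu₁ - h₁ u))
  have huy : u = y * u' := Subtype.ext (funext fun z => rpow_eq_mul_rpow_sub_one hn0 (F z))
  -- `y k = 0` gives `k + y Y k = 0`, hence `k² = 0`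
  have cancel_y : ∀ k, y * k = 0 → k = 0 := fun k hk => by
    have := congrArg Y hk
    simp only [map_zero, Derivation.leibniz, smul_eq_mul, hYy] at this
    exact eq_zero_of_mul_self (by linear_combination k * this - Y k * hk)
  have cancel_u : ∀ k, u * k = 0 → k = 0 := fun k hk => by
    refine cancel_y k (Subtype.ext (funext fun z => ?_))
    have hz : F z ^ n * k.1 z = 0 := congrFun (congrArg Subtype.val hk) z
    change F z * k.1 z = 0
    by_cases h0 : F z = 0
    · rw [h0, zero_mul]
    · rw [(mul_eq_zero.1 hz).resolve_left ((hF z z.2).rpow_ne_zero h0), mul_zero]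
  have hconst : ∀ k, X k = 0 → Y k = 0 → ∃ c : ℝ, k = algebraMap ℝ _ c := fun k hX hY =>
    exists_eq_algebraMap hV.isPreconnected (by rw [h₁, hX, hY]; ring) (by rw [h₂, hX, hY]; ring)
  obtain ⟨Ω, hΩ, heq⟩ := transformed_equation (x := x) (y := y)
    (r := -(algebraMap ℝ _ δ * u)) (fun _ => rfl) (fun _ => rfl) (fun _ _ => rfl) hJ
    (fun z => by
      change Continuous fun p : ℝ => -(f z.2 * p + g z.2)
      fun_prop) h
  obtain ⟨e, he⟩ := exists_frame_equiv hJ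
  have hsol : ∀ v : SmoothVectorFields V, IsPointSymmetry (lienard f g) V v.1 ↔
      ∃ c : ℝ × ℝ × ℝ, (n ≠ -3 → c.2.2 = 0) ∧ e.symm (quadraticPair (2 / (1 - n)) x y c) = v := by
    intro v
    rw [isPointSymmetry_iff hΩ hJ heq h₁ h₂]
    refine (determining_iff X Y (dual_derivations_commute _ _ X Y dSnd_dFst x y hJ h₁ h₂) hn0 hn1
      hδ hXx hYx hXy hYy hXu hYu huy cancel_u cancel_y hconst rfl
      (apply x v, apply y v)).trans ?_
    simp only [LinearEquiv.symm_apply_eq, he]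
  have hlie : ∀ c c', e.symm (quadraticPair (2 / (1 - n)) x y (c.1 * c'.2.1 - c.2.1 * c'.1,
      2 * (c.1 * c'.2.2 - c.2.2 * c'.1), c.2.1 * c'.2.2 - c.2.2 * c'.2.1)) =
      ⁅e.symm (quadraticPair (2 / (1 - n)) x y c), e.symm (quadraticPair (2 / (1 - n)) x y c')⁆ :=
    fun c c' => by
      rw [LinearEquiv.symm_apply_eq, he]
      exact frame_bracket h₁ h₂ hXx hYx hXy hYy _ (by rw [← he, LinearEquiv.apply_symm_apply])
        (by rw [← he, LinearEquiv.apply_symm_apply])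
  have hinj := e.symm.injective.comp
    (quadraticPair_injective (y := y) X Y (2 / (1 - n)) hXx hYx)
  constructor
  · intro hn
    -- the condition `c₂ = 0` leaves the parameters `(c₀, c₁)`
    have := hasPointSymmetryAlgebraOfDim_of_range (Ω := lienard f g)
      (e.symm.toLinearMap ∘ₗ quadraticPair (2 / (1 - n)) x y ∘ₗ
        LinearMap.prodMap LinearMap.id (LinearMap.inl ℝ ℝ ℝ)) ?_ ?_ ?_
    · simpa using this
    · exact hinj.comp (Function.injective_id.prodMap LinearMap.inl_injective)
    · intro v
      rw [hsol]
      constructor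
      · rintro ⟨⟨a, b, c⟩, hc, hv⟩
        obtain rfl : c = 0 := hc hn
        exact ⟨(a, b), hv⟩
      · rintro ⟨c, hv⟩
        exact ⟨(c.1, c.2, 0), fun _ => rfl, hv⟩
    · rintro c c'
      refine ⟨(c.1 * c'.2 - c.2 * c'.1, 0), ?_⟩
      have := hlie (c.1, c.2, 0) (c'.1, c'.2, 0)
      simp only [mul_zero, zero_mul, sub_zero] at this
      exact this
  · intro hn
    have := hasPointSymmetryAlgebraOfDim_of_range (Ω := lienard f g)
      (e.symm.toLinearMap ∘ₗ quadraticPair (2 / (1 - n)) x y) hinj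
      (fun v => (hsol v).trans ⟨fun ⟨c, _, hc⟩ => ⟨c, hc⟩,
        fun ⟨c, hc⟩ => ⟨c, fun h => (h hn).elim, hc⟩⟩)
      (fun c c' => ⟨_, hlie c c'⟩)
    simpa using this
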